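/- All rings are unital and possibly non commutative. A left and right artinian ring $R$ with Jacobson radical $J$ is *Frobenius* if $\operatorname{Soc}({}_RR)\cong R/J$ as left $R$-modules and $\operatorname{Soc}(R_R)\cong R/J$ as right $R$-modules. Let $K$ be a commutative Frobenius ring. A $K$-algebra $R$ is a *non projective Frobenius $K$-algebra* (meaning: not necessarily projective) if $R$ is finitely generated as a $K$-module and there is an associative ($\langle ab,c\rangle=\langle a,bc\rangle$), left and right non degenerate $K$-bilinear form $\langle -,-\rangle:R\times R\to K$; a $K$-linear form $\epsilon:R\to K$ is a *Frobenius functional* if $\langle a,b\rangle=\epsilon(ab)$ for all $a,b$, for some such form. **Theorem.** Let $K$ be a commutative Frobenius ring, $A$ a non projective Frobenius $K$-algebra with Frobenius functional $\epsilon:A\to K$, and $\sigma$ a $K$-algebra automorphism of $A$. Let $S=A[x;\sigma]$ be the skew polynomial ring (coefficients on the left, $xa=\sigma(a)x$), and let $f=\sum_{i=0}^m f_ix^i\in S$ be monic of degree $m$ with $f_0$ a unit of $A$, such that the left ideal $Sf$ is two-sided. Let $\mathcal R=S/Sf$. Then every class in $\mathcal R$ has a unique representative in $S$ of degree less than $m$;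 for $u\in\mathcal R$ let $u_0\in A$ denote the term of degree $0$ of that representative. The formula $$\langle g,h\rangle=\epsilon\big((gh)_0\big),\qquad g,h\in\mathcal R,$$ defines an associative, (left and right) non degenerate $K$-bilinear form $\mathcal R\times\mathcal R\to K$, $\mathcal R$ is a non projective Frobenius $K$-algebra, and $\mathcal R$ is a Frobenius ring. -/

import Mathlib

/-- The socle of a module: the sum of all its simple submodules. -/
def moduleSocle (R M : Type*) [Ring R] [AddCommGroup M] [Module R M] : Submodule R M :=
  sSup {N : Submodule R M | IsSimpleModule R N}

/-- The Jacobson radical `J` of `R`, regarded as a right ideal, i.e. as a submodule of the right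
module `R_R` (right modules are modules over `Rᵐᵒᵖ`). -/
def jacobsonRight (R : Type*) [Ring R] : Submodule Rᵐᵒᵖ R where
  carrier := Ring.jacobson R
  add_mem' := fun ha hb => (Ring.jacobson R).add_mem ha hb
  zero_mem' := (Ring.jacobson R).zero_mem
  smul_mem' := fun c _ ha => Ideal.mul_mem_right c.unop (Ring.jacobson R) ha

/-- A left and right artinian ring `R` with Jacobson radical `J` is Frobenius if
`Soc(R) ≅ R/J` both as left `R`-modules and as right `R`-modules. -/
structure IsFrobeniusRing (R : Type*) [Ring R] : Prop where
  artinian_left : IsArtinian R R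
  artinian_right : IsArtinian Rᵐᵒᵖ R
  socle_left : Nonempty (moduleSocle R R ≃ₗ[R] (R ⧸ Ring.jacobson R))
  socle_right : Nonempty (moduleSocle Rᵐᵒᵖ R ≃ₗ[Rᵐᵒᵖ] (R ⧸ jacobsonRight R))

/-- A `K`-bilinear form on a `K`-algebra is associative if `⟨a b, c⟩ = ⟨a, b c⟩`. -/
def IsAssociativeForm {K R : Type*} [CommRing K] [Ring R] [Algebra K R]
    (B : R →ₗ[K] R →ₗ[K] K) : Prop :=
  ∀ a b c : R, B (a * b) c = B a (b * c)

/-- A (not necessarily projective) Frobenius algebra over `K` (to be used for `K` a commutative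
Frobenius ring): a `K`-algebra which is finitely generated as a `K`-module and has a left and right
non degenerate associative `K`-bilinear form. -/
def IsNonprojectiveFrobenius (K R : Type*) [CommRing K] [Ring R] [Algebra K R] : Prop :=
  Module.Finite K R ∧ ∃ B : R →ₗ[K] R →ₗ[K] K, IsAssociativeForm B ∧ B.Nondegenerate

/-- A Frobenius functional: a `K`-linear form `ε` which comes from a non degenerate associative
bilinear form through `⟨a, b⟩ = ε (a b)`. -/
def IsFrobeniusFunctional {K R : Type*} [CommRing K] [Ring R] [Algebra K R]
    (ε : R →ₗ[K] K) : Prop :=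
  ∃ B : R →ₗ[K] R →ₗ[K] K, IsAssociativeForm B ∧ B.Nondegenerate ∧ ∀ a b : R, B a b = ε (a * b)

section SkewPoly

variable {K A : Type*} [CommRing K] [Ring A] [Algebra K A]

/-- The action of the powers of `σ` on `A`: `n` acts as `σ ^ n`. -/
abbrev powersAction (σ : A ≃ₐ[K] A) : MulSemiringAction (Multiplicative ℕ) A :=
  MulSemiringAction.compHom A (powersHom (A ≃ₐ[K] A) σ)

/-- The skew polynomial ring `A[x;σ]`: polynomials with coefficients in `A` written on the left,
with multiplication determined by `x a = σ(a) x`. -/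
def SkewPoly (_σ : A ≃ₐ[K] A) : Type _ := SkewPolynomial A

namespace SkewPoly

variable (σ : A ≃ₐ[K] A)

noncomputable instance : Ring (SkewPoly σ) :=
  letI := powersAction σ
  inferInstanceAs (Ring (SkewPolynomial A))

theorem powersAction_smulCommClass :
    letI := powersAction σ
    SMulCommClass (Multiplicative ℕ) K A :=
  letI := powersAction σ
  ⟨fun n k a => map_smul (powersHom (A ≃ₐ[K] A) σ n) k a⟩

/-- `A[x;σ]` is a `K`-algebra, through the constant polynomials. -/
noncomputable instance : Algebra K (SkewPoly σ) :=
  letI := powersAction σ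
  letI := powersAction_smulCommClass σ
  (inferInstance : Algebra K (SkewMonoidAlgebra A (Multiplicative ℕ)))

variable {σ}

/-- The coefficient of `x ^ n`. -/
def coeff (p : SkewPoly σ) (n : ℕ) : A := SkewPolynomial.coeff (p : SkewPolynomial A) n

/-- `p` has degree less than `m`. -/
def DegreeLT (p : SkewPoly σ) (m : ℕ) : Prop := ∀ n, m ≤ n → p.coeff n = 0

/-- `p = x ^ m + (terms of degree less than m)`. -/
def IsMonicOfDegree (p : SkewPoly σ) (m : ℕ) : Prop :=
  p.coeff m = 1 ∧ ∀ n, m < n → p.coeff n = 0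

end SkewPoly

end SkewPoly

/-!
Write `R = A[x;σ]/(f)`.

*The form on `R`.* Division by the monic polynomial `f` gives unique remainders of degree less
than `m`, and associativity of `⟨g, h⟩ = ε ((g h)₀)` is that of `R`. Nondegeneracy rests on the
invertibility of `x` modulo `f`, which follows from `f₀` being a unit (`SkewPoly.isUnit_mk_X`). If
`g` is orthogonal to `R`, then pairing with constants and nondegeneracy of `ε` give `g₀ = 0`; so
`g = g' x` with `g'` of smaller degree, and `g'` is orthogonal to `x R = R`. Induction on the
degree gives `g = 0`; the other side is symmetric, with `g = x g'`.

*`R` is a Frobenius ring.* This holds for every finite `K`-algebra `R` with a nondegenerate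
associative form (`IsNonprojectiveFrobenius.isFrobeniusRing`), and lengths over `K` suffice to
prove it. Duality over `K` does not increase length (`IsFrobeniusRing.length_dual_le`), so the
form identifies `R` with its `K`-dual. The semisimple ring `R/J` has a functional whose kernel
contains no nonzero left ideal, by Wedderburn–Artin; its pullback to `R` has the form `⟨-, s⟩`,
and then `r ↦ r s` embeds `R/J` into the left socle. The socle pairs to zero with `J`, hence
embeds into the dual of `R/J` and is not longer than `R/J`; so the embedding is onto. The
right-hand statement is the left-hand one for `Rᵐᵒᵖ`.
-/

/-! ### Duality over a commutative Frobenius ring -/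

theorem IsFrobeniusRing.isArtinianRing {R : Type*} [Ring R] (hR : IsFrobeniusRing R) :
    IsArtinianRing R := hR.artinian_left

theorem isSemisimpleModule_quotient_jacobson (R : Type*) [Ring R] [IsArtinianRing R] :
    IsSemisimpleModule R (R ⧸ Ring.jacobson R) :=
  (LinearMap.isSemisimpleModule_iff_of_bijective
    (σ := Ideal.Quotient.mk (Ring.jacobson R))
    ({ toFun := id, map_add' := fun _ _ => rfl, map_smul' := fun _ _ => rfl } :
      (R ⧸ Ring.jacobson R) →ₛₗ[Ideal.Quotient.mk (Ring.jacobson R)] (R ⧸ Ring.jacobson R))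
    Function.bijective_id).mpr inferInstance

/-- Over a commutative Frobenius ring the dual of a simple module is zero or simple: evaluation at
a nonzero vector embeds it into the part of `Soc K ≅ K / J` that is annihilated by a maximal
ideal `𝔪`, and that part embeds into `K / 𝔪`, because `K / J` is reduced. -/
theorem IsFrobeniusRing.length_dual_le_one {K M : Type*} [CommRing K] (hK : IsFrobeniusRing K)
    [AddCommGroup M] [Module K M] [IsSimpleModule K M] :
    Module.length K (M →ₗ[K] K) ≤ 1 := by
  obtain ⟨e⟩ := hK.socle_left
  have hsemi : IsSemisimpleRing (K ⧸ Ring.jacobson K) :=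
    have := hK.isArtinianRing
    inferInstance
  have := IsSimpleModule.nontrivial K M
  obtain ⟨v, hv⟩ := exists_ne (0 : M)
  have hm := IsSimpleModule.ker_toSpanSingleton_isMaximal K hv
  set 𝔪 : Ideal K := LinearMap.ker (LinearMap.toSpanSingleton K M v) with h𝔪
  have hsimple : IsSimpleModule K (K ⧸ 𝔪) := isSimpleModule_iff_isCoatom.mpr hm.out
  have hJ : Ring.jacobson K ≤ 𝔪 := Ring.jacobson_le_of_isMaximal 𝔪
  have hsoc : ∀ g : M →ₗ[K] K, g v ∈ moduleSocle K K := by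
    intro g
    rcases eq_or_ne g 0 with rfl | hg
    · simp
    · have hle : LinearMap.range g ≤ moduleSocle K K := le_sSup
        (IsSimpleModule.congr (LinearEquiv.ofInjective g (LinearMap.injective_of_ne_zero hg)).symm)
      exact hle ⟨v, rfl⟩
  let ev : (M →ₗ[K] K) →ₗ[K] moduleSocle K K :=
    LinearMap.codRestrict _ (LinearMap.applyₗ v) hsoc
  let F : (M →ₗ[K] K) →ₗ[K] K ⧸ 𝔪 := Submodule.factor hJ ∘ₗ e.toLinearMap ∘ₗ ev
  rw [← Module.length_eq_one K (K ⧸ 𝔪)]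
  refine Module.length_le_of_injective F ((injective_iff_map_eq_zero F).mpr fun g hg => ?_)
  obtain ⟨y, hy⟩ := Ideal.Quotient.mk_surjective (e (ev g))
  have hy𝔪 : y ∈ 𝔪 := by
    have : F g = Submodule.factor hJ (Ideal.Quotient.mk _ y) := by rw [hy]; rfl
    rw [this] at hg
    exact (Submodule.Quotient.mk_eq_zero _).mp hg
  have hyv : y • v = 0 := by simpa [h𝔪] using hy𝔪
  have hyy : y • e (ev g) = 0 := by
    rw [← map_smul]
    have : y • ev g = 0 := by
      ext
      change y • g v = 0
      rw [← map_smul, hyv, map_zero]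
    rw [this, map_zero]
  have hsq : Ideal.Quotient.mk (Ring.jacobson K) y ^ 2 = 0 := by
    rw [pow_two, ← hyy, ← hy]; rfl
  have hz : ev g = 0 := by
    apply e.injective
    rw [map_zero, ← hy]
    exact eq_zero_of_pow_eq_zero hsq
  have hgv : g v = 0 := congrArg Subtype.val hz
  by_contra hne
  exact hv (LinearMap.injective_of_ne_zero hne (by rw [hgv, map_zero]))

theorem IsFrobeniusRing.length_dual_le_of_isFiniteLength {K : Type*} [CommRing K]
    (hK : IsFrobeniusRing K) {M : Type*} [AddCommGroup M] [Module K M] (hM : IsFiniteLength K M) :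
    Module.length K (M →ₗ[K] K) ≤ Module.length K M := by
  induction hM with
  | of_subsingleton => simp [Module.length_eq_zero]
  | @of_simple_quotient M _ _ N _ _ ih =>
    let res : (M →ₗ[K] K) →ₗ[K] (N →ₗ[K] K) := LinearMap.lcomp K K N.subtype
    let infl : (M ⧸ N →ₗ[K] K) →ₗ[K] (M →ₗ[K] K) := LinearMap.lcomp K K N.mkQ
    have hinfl : Function.Injective infl := fun a b hab =>
      LinearMap.cancel_right N.mkQ_surjective |>.mp hab
    let res' : (M →ₗ[K] K) →ₗ[K] LinearMap.range res := res.rangeRestrict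
    have hexact : Function.Exact infl res' := by
      intro g
      rw [Subtype.ext_iff]
      constructor
      · intro hg
        refine ⟨N.liftQ g fun x hx => LinearMap.congr_fun hg ⟨x, hx⟩, ?_⟩
        ext x
        rfl
      · rintro ⟨g, rfl⟩
        ext x
        change g (N.mkQ x) = 0
        rw [N.mkQ_apply, (Submodule.Quotient.mk_eq_zero N).mpr x.2, map_zero]
    have hlen := Module.length_eq_add_of_exact (R := K) (P := LinearMap.range res) infl res' hinfl
      res.surjective_rangeRestrict hexact
    rw [hlen,
      Module.length_eq_add_of_exact N.subtype N.mkQ N.subtype_injective N.mkQ_surjective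
        (LinearMap.exact_subtype_mkQ N), add_comm, Module.length_eq_one K (M ⧸ N)]
    exact add_le_add ((Module.length_le_of_injective _ (Submodule.subtype_injective _)).trans ih)
      hK.length_dual_le_one

/-- Duality over a commutative Frobenius ring does not increase length. -/
theorem IsFrobeniusRing.length_dual_le {K : Type*} [CommRing K]
    (hK : IsFrobeniusRing K) (M : Type*) [AddCommGroup M] [Module K M] [Module.Finite K M] :
    Module.length K (M →ₗ[K] K) ≤ Module.length K M := by
  have := hK.isArtinianRing
  exact hK.length_dual_le_of_isFiniteLength
    (isFiniteLength_iff_isNoetherian_isArtinian.mpr ⟨inferInstance, inferInstance⟩)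

/-- A nonzero finitely generated module over a commutative Frobenius ring has a nonzero linear
functional: it maps onto a simple module `K / 𝔪`, which is a direct summand of the semisimple
module `K / J ≅ Soc K`. -/
theorem IsFrobeniusRing.exists_dual_ne_zero {K : Type*} [CommRing K]
    (hK : IsFrobeniusRing K) (M : Type*) [AddCommGroup M] [Module K M] [Module.Finite K M]
    [Nontrivial M] : ∃ g : M →ₗ[K] K, g ≠ 0 := by
  have := hK.isArtinianRing
  obtain ⟨e⟩ := hK.socle_left
  obtain ⟨N, hN⟩ := IsCoatomic.exists_coatom (Submodule K M)
  have hsimple : IsSimpleModule K (M ⧸ N) := isSimpleModule_iff_isCoatom.mpr hN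
  have : Nontrivial (M ⧸ N) := IsSimpleModule.nontrivial K _
  obtain ⟨w, hw⟩ := exists_ne (0 : M ⧸ N)
  have hm := IsSimpleModule.ker_toSpanSingleton_isMaximal K hw
  have hsemi := isSemisimpleModule_quotient_jacobson K
  let q : (K ⧸ Ring.jacobson K) →ₗ[K] M ⧸ N :=
    (Ring.jacobson K).liftQ (LinearMap.toSpanSingleton K _ w) (Ring.jacobson_le_of_isMaximal _)
  have hq : Function.Surjective q := by
    intro x
    obtain ⟨a, rfl⟩ := IsSimpleModule.toSpanSingleton_surjective K hw x
    exact ⟨Submodule.Quotient.mk a, rfl⟩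
  obtain ⟨s, hs⟩ := IsSemisimpleModule.lifting_property q hq LinearMap.id
  let g : M →ₗ[K] K := (moduleSocle K K).subtype ∘ₗ e.symm.toLinearMap ∘ₗ s ∘ₗ N.mkQ
  refine ⟨g, fun h0 => ?_⟩
  obtain ⟨v, rfl⟩ := N.mkQ_surjective w
  have h1 : g v = 0 := by rw [h0]; rfl
  have h2 : s (N.mkQ v) = 0 := by
    have : e.symm (s (N.mkQ v)) = 0 := Subtype.ext h1
    simpa using this
  apply hw
  rw [← LinearMap.id_apply (R := K) (N.mkQ v), ← hs, LinearMap.comp_apply, h2, map_zero]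

/-! ### Functionals that detect the Jacobson radical -/

/-- A finite semisimple algebra over a commutative Frobenius ring carries a linear functional whose
kernel contains no nonzero left ideal: on a product of matrix rings over division algebras `D i`,
the sum of the traces followed by nonzero functionals on the `D i`. -/
theorem IsFrobeniusRing.exists_functional_of_isSemisimpleRing {K B : Type*} [CommRing K]
    (hK : IsFrobeniusRing K) [Ring B] [Algebra K B] [Module.Finite K B] [IsSemisimpleRing B] :
    ∃ μ : B →ₗ[K] K, ∀ x, (∀ y, μ (y * x) = 0) → x = 0 := by
  obtain ⟨n, D, d, _, _, _, _, ⟨e⟩⟩ :=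
    IsSemisimpleRing.exists_algEquiv_pi_matrix_divisionRing_finite K B
  choose g hg using fun i => hK.exists_dual_ne_zero (D i)
  let μ : B →ₗ[K] K := (∑ i, g i ∘ₗ Matrix.traceLinearMap (Fin (d i)) K (D i) ∘ₗ
    LinearMap.proj (φ := fun i => Matrix (Fin (d i)) (Fin (d i)) (D i)) i) ∘ₗ e.toLinearMap
  have hμ : ∀ b, μ b = ∑ i, g i (Matrix.trace (e b i)) := fun b => by simp [μ]
  refine ⟨μ, fun x hx => ?_⟩
  apply e.injective
  rw [map_zero]
  ext i j k
  by_contra hc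
  change e x i j k ≠ 0 at hc
  obtain ⟨a, ha⟩ : ∃ a, g i a ≠ 0 := by
    by_contra! h
    exact hg i (LinearMap.ext h)
  apply ha
  -- multiplying by a suitable matrix unit isolates the entry `(j, k)` on the diagonal
  have := hx (e.symm (Pi.single i (Matrix.single k j (a * (e x i j k)⁻¹))))
  rw [hμ, Finset.sum_eq_single i] at this
  · simpa [Matrix.trace_single_mul, hc] using this
  · intro b _ hb
    simp [hb]
  · simp

/-- A finite algebra over a commutative Frobenius ring carries a linear functional vanishing on the
Jacobson radical, such that every left ideal in its kernel lies in the radical. -/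
theorem IsFrobeniusRing.exists_functional {K R : Type*} [CommRing K]
    (hK : IsFrobeniusRing K) [Ring R] [Algebra K R] [Module.Finite K R] [IsArtinianRing R] :
    ∃ μ : R →ₗ[K] K, (∀ x ∈ Ring.jacobson R, μ x = 0) ∧
      ∀ x, (∀ y, μ (y * x) = 0) → x ∈ Ring.jacobson R := by
  have : Module.Finite K (R ⧸ Ring.jacobson R) :=
    Module.Finite.of_surjective (Ideal.Quotient.mkₐ K (Ring.jacobson R)).toLinearMap
      Ideal.Quotient.mk_surjective
  obtain ⟨μ, hμ⟩ := hK.exists_functional_of_isSemisimpleRing (B := R ⧸ Ring.jacobson R)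
  refine ⟨μ ∘ₗ (Ideal.Quotient.mkₐ K (Ring.jacobson R)).toLinearMap, fun x hx => ?_, fun x hx => ?_⟩
  · change μ (Ideal.Quotient.mk _ x) = 0
    rw [Ideal.Quotient.eq_zero_iff_mem.mpr hx, map_zero]
  · rw [← Ideal.Quotient.eq_zero_iff_mem]
    refine hμ _ fun y => ?_
    obtain ⟨y, rfl⟩ := Ideal.Quotient.mk_surjective y
    rw [← map_mul]
    exact hx y

/-! ### Socles and semisimple modules -/

instance moduleSocle.isSemisimpleModule (R M : Type*) [Ring R] [AddCommGroup M] [Module R M] :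
    IsSemisimpleModule R (moduleSocle R M) := by
  have := isSemisimpleModule_biSup_of_isSemisimpleModule_submodule
    (R := R) (s := {N : Submodule R M | IsSimpleModule R N}) (p := id)
    fun N hN => by
      have : IsSimpleModule R N := hN
      exact inferInstanceAs (IsSemisimpleModule R N)
  rw [moduleSocle, sSup_eq_iSup]
  exact this

theorem smul_eq_zero_of_mem_jacobson_of_mem_moduleSocle {R M : Type*} [Ring R] [AddCommGroup M]
    [Module R M] {r : R} (hr : r ∈ Ring.jacobson R) {x : M} (hx : x ∈ moduleSocle R M) :
    r • x = 0 := by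
  have h := Module.mem_annihilator.mp
    (IsSemisimpleModule.jacobson_le_annihilator R (moduleSocle R M) hr) ⟨x, hx⟩
  exact congrArg Subtype.val h

theorem le_moduleSocle_of_isSemisimpleModule {R M : Type*} [Ring R] [AddCommGroup M] [Module R M]
    (N : Submodule R M) [IsSemisimpleModule R N] : N ≤ moduleSocle R M := by
  have h : Submodule.map N.subtype ⊤ = N := by simp
  rw [← h, ← IsSemisimpleModule.sSup_simples_eq_top R N, Submodule.map_le_iff_le_comap, sSup_le_iff]
  intro P hP
  have hP : IsSimpleModule R P := hP
  rw [← Submodule.map_le_iff_le_comap]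
  exact le_sSup (IsSimpleModule.congr
    (P.equivMapOfInjective N.subtype N.subtype_injective).symm)

theorem range_le_moduleSocle {R M N : Type*} [Ring R] [AddCommGroup M] [Module R M]
    [AddCommGroup N] [Module R N] [IsSemisimpleModule R M] (g : M →ₗ[R] N) :
    LinearMap.range g ≤ moduleSocle R N :=
  have := IsSemisimpleModule.range g
  le_moduleSocle_of_isSemisimpleModule _

/-! ### Socles of nonprojective Frobenius algebras -/

/-- An injective linear map into a module of smaller or equal finite length is surjective. -/
theorem LinearMap.surjective_of_injective_of_length_le {K M N : Type*} [Ring K]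
    [AddCommGroup M] [Module K M] [AddCommGroup N] [Module K N] [IsArtinian K M] [IsNoetherian K M]
    (g : M →ₗ[K] N) (hg : Function.Injective g) (hlen : Module.length K N ≤ Module.length K M) :
    Function.Surjective g := by
  have hM := Module.length_ne_top (R := K) (M := M)
  have hadd := Module.length_eq_add_of_exact g (LinearMap.range g).mkQ hg
    (Submodule.mkQ_surjective _) (LinearMap.exact_map_mkQ_range g)
  have h0 : Module.length K (N ⧸ LinearMap.range g) = 0 := by
    rw [hadd] at hlen
    exact nonpos_iff_eq_zero.mp ((ENat.add_le_add_iff_left hM).mp (hlen.trans_eq (add_zero _).symm))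
  rw [Module.length_eq_zero_iff, Submodule.Quotient.subsingleton_iff] at h0
  exact LinearMap.range_eq_top.mp h0

/-- The socle pairs to zero with the radical `J`, so a nondegenerate associative form embeds it into
the dual of `R / J`. -/
theorem length_moduleSocle_le {K R : Type*} [CommRing K] [Ring R]
    [Algebra K R] [Module.Finite K R] (hK : IsFrobeniusRing K) (B : R →ₗ[K] R →ₗ[K] K)
    (hass : IsAssociativeForm B) (hB : B.Nondegenerate) :
    Module.length K (moduleSocle R R) ≤ Module.length K (R ⧸ Ring.jacobson R) := by
  let J : Submodule K R := (Ring.jacobson R).restrictScalars K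
  let θ : moduleSocle R R →ₗ[K] J.dualAnnihilator :=
    LinearMap.codRestrict _ (B.flip ∘ₗ (moduleSocle R R).subtype.restrictScalars K) fun x => by
      rw [Submodule.mem_dualAnnihilator]
      intro r hr
      change B r x = 0
      have h : r * (x : R) = 0 := smul_eq_zero_of_mem_jacobson_of_mem_moduleSocle hr x.2
      have h1 := hass 1 r x
      rwa [one_mul, h, map_zero] at h1
  have hθ : Function.Injective θ := (injective_iff_map_eq_zero θ).mpr fun x hx =>
    Subtype.ext (hB.2 x fun y => LinearMap.congr_fun (congrArg Subtype.val hx) y)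
  calc Module.length K (moduleSocle R R)
      ≤ Module.length K J.dualAnnihilator := Module.length_le_of_injective θ hθ
    _ = Module.length K (R ⧸ J →ₗ[K] K) := J.dualQuotEquivDualAnnihilator.symm.length_eq
    _ ≤ Module.length K (R ⧸ J) := hK.length_dual_le _
    _ = Module.length K (R ⧸ Ring.jacobson R) :=
      (Submodule.Quotient.restrictScalarsEquiv K (Ring.jacobson R)).length_eq

/-- The left half of the Frobenius property of a nonprojective Frobenius algebra `R`.
By a length count every functional is of the form `⟨-, s⟩`. For the functional that detects the
radical, `x ↦ x s` embeds `R / J` into the socle, and the socle, which pairs with `J` to zero,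
embeds into the dual of `R / J` and so is not longer than `R / J`. -/
theorem IsNonprojectiveFrobenius.nonempty_moduleSocle_equiv {K R : Type*} [CommRing K] [Ring R]
    [Algebra K R] (hK : IsFrobeniusRing K) (hR : IsNonprojectiveFrobenius K R) :
    Nonempty (moduleSocle R R ≃ₗ[R] R ⧸ Ring.jacobson R) := by
  obtain ⟨hfin, B, hass, hB⟩ := hR
  have := hK.isArtinianRing
  have : IsArtinianRing R := isArtinian_of_tower K inferInstance
  have : Module.Finite K (R ⧸ Ring.jacobson R) :=
    Module.Finite.of_surjective (Ideal.Quotient.mkₐ K (Ring.jacobson R)).toLinearMap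
      Ideal.Quotient.mk_surjective
  obtain ⟨μ, hμJ, hμ⟩ := hK.exists_functional (R := R)
  have hsurj : Function.Surjective B.flip :=
    B.flip.surjective_of_injective_of_length_le
      ((injective_iff_map_eq_zero B.flip).mpr fun x hx =>
        hB.2 x fun y => LinearMap.congr_fun hx y)
      (hK.length_dual_le R)
  obtain ⟨s, hs⟩ := hsurj μ
  have hs' : ∀ x, B x s = μ x := fun x => LinearMap.congr_fun hs x
  have hmul : ∀ x, x * s = 0 ↔ x ∈ Ring.jacobson R := by
    intro x
    constructor
    · intro hx
      refine hμ x fun y => ?_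
      rw [← hs', hass, hx, map_zero]
    · intro hx
      refine hB.2 _ fun y => ?_
      rw [← hass, hs', hμJ _ (Ideal.mul_mem_left _ _ hx)]
  have hsemi := isSemisimpleModule_quotient_jacobson R
  let φ : (R ⧸ Ring.jacobson R) →ₗ[R] R :=
    (Ring.jacobson R).liftQ (LinearMap.toSpanSingleton R R s) fun x hx => (hmul x).mpr hx
  have hφ : Function.Injective φ := by
    refine (injective_iff_map_eq_zero φ).mpr fun x hx => ?_
    obtain ⟨x, rfl⟩ := Ideal.Quotient.mk_surjective x
    exact Ideal.Quotient.eq_zero_iff_mem.mpr ((hmul x).mp hx)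
  let ψ : (R ⧸ Ring.jacobson R) →ₗ[R] moduleSocle R R :=
    φ.codRestrict _ fun x => range_le_moduleSocle φ ⟨x, rfl⟩
  have hψ : Function.Injective ψ := fun x y hxy => hφ (congrArg Subtype.val hxy)
  have hlen := length_moduleSocle_le hK B hass hB
  have hψs : Function.Surjective ψ :=
    (ψ.restrictScalars K).surjective_of_injective_of_length_le hψ hlen
  exact ⟨(LinearEquiv.ofBijective ψ ⟨hψ, hψs⟩).symm⟩

/-! ### Passage to the opposite ring -/

theorem IsNonprojectiveFrobenius.op {K R : Type*} [CommRing K] [Ring R] [Algebra K R]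
    (hR : IsNonprojectiveFrobenius K R) : IsNonprojectiveFrobenius K Rᵐᵒᵖ := by
  obtain ⟨hfin, B, hass, hB⟩ := hR
  let o : Rᵐᵒᵖ ≃ₗ[K] R := (MulOpposite.opLinearEquiv K).symm
  refine ⟨Module.Finite.equiv o.symm, B.flip.compl₁₂ o.toLinearMap o.toLinearMap, ?_, ?_, ?_⟩
  · intro a b c
    exact (hass c.unop b.unop a.unop).symm
  · intro x hx
    exact MulOpposite.unop_injective (hB.2 x.unop fun y => hx (MulOpposite.op y))
  · intro x hx
    exact MulOpposite.unop_injective (hB.1 x.unop fun y => hx (MulOpposite.op y))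

/-- By nilpotency of the radical, `1 + x y` is invertible for `x` in the radical and any `y`; read
in `Rᵐᵒᵖ`, this is the criterion for membership in the radical. -/
theorem MulOpposite.op_mem_jacobson {R : Type*} [Ring R] [IsArtinianRing R] {x : R}
    (hx : x ∈ Ring.jacobson R) : MulOpposite.op x ∈ Ring.jacobson Rᵐᵒᵖ := by
  rw [← Ideal.jacobson_bot, Ideal.mem_jacobson_iff]
  intro y
  obtain ⟨n, hn⟩ := IsSemiprimaryRing.isNilpotent (R := R)
  have hnil : IsNilpotent (x * y.unop) := by
    refine ⟨n, ?_⟩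
    have := Ideal.pow_mem_pow (Ideal.mul_mem_right y.unop _ hx) n
    rwa [hn] at this
  obtain ⟨u, hu⟩ := hnil.isUnit_one_add
  refine ⟨MulOpposite.op (↑u⁻¹ : R), ?_⟩
  apply MulOpposite.unop_injective
  have : (1 + x * y.unop) * (↑u⁻¹ : R) = 1 := by rw [← hu, Units.mul_inv]
  simp only [MulOpposite.unop_sub, MulOpposite.unop_add, MulOpposite.unop_mul,
    MulOpposite.unop_op, MulOpposite.unop_one, MulOpposite.unop_zero]
  rw [← mul_assoc, sub_eq_zero, ← this, add_mul, one_mul, add_comm]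

theorem MulOpposite.op_mem_jacobson_iff {R : Type*} [Ring R] [IsArtinianRing R]
    [IsArtinianRing Rᵐᵒᵖ] {x : R} :
    MulOpposite.op x ∈ Ring.jacobson Rᵐᵒᵖ ↔ x ∈ Ring.jacobson R := by
  refine ⟨fun h => ?_, MulOpposite.op_mem_jacobson⟩
  have : IsArtinianRing Rᵐᵒᵖᵐᵒᵖ := (RingEquiv.opOp R).surjective.isArtinianRing
  have h2 := MulOpposite.op_mem_jacobson h
  have : RingHomSurjective ((RingEquiv.opOp R).symm : Rᵐᵒᵖᵐᵒᵖ →+* R) :=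
    ⟨(RingEquiv.opOp R).symm.surjective⟩
  exact Ring.le_comap_jacobson ((RingEquiv.opOp R).symm : Rᵐᵒᵖᵐᵒᵖ →+* R) h2

/-- A linear equivalence carries the socle onto the socle. -/
theorem map_moduleSocle {R M N : Type*} [Ring R] [AddCommGroup M] [Module R M]
    [AddCommGroup N] [Module R N] (e : M ≃ₗ[R] N) :
    (moduleSocle R M).map e.toLinearMap = moduleSocle R N := by
  apply le_antisymm
  · have := range_le_moduleSocle (e.toLinearMap ∘ₗ (moduleSocle R M).subtype)
    rwa [LinearMap.range_comp, Submodule.range_subtype] at this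
  · have := range_le_moduleSocle (e.symm.toLinearMap ∘ₗ (moduleSocle R N).subtype)
    rw [LinearMap.range_comp, Submodule.range_subtype] at this
    intro x hx
    exact ⟨e.symm x, this ⟨x, hx, rfl⟩, e.apply_symm_apply x⟩

/-- The right regular module of `R` is the left regular module of `Rᵐᵒᵖ`. -/
def rightRegularEquiv (R : Type*) [Ring R] : R ≃ₗ[Rᵐᵒᵖ] Rᵐᵒᵖ where
  __ := MulOpposite.opAddEquiv
  map_smul' _ _ := rfl

/-- A nonprojective Frobenius algebra over a commutative Frobenius ring is a Frobenius ring. -/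
theorem IsNonprojectiveFrobenius.isFrobeniusRing {K R : Type*} [CommRing K] [Ring R]
    [Algebra K R] (hK : IsFrobeniusRing K) (hR : IsNonprojectiveFrobenius K R) :
    IsFrobeniusRing R := by
  have := hR.1
  have := hR.op.1
  have := hK.isArtinianRing
  have h1 : IsArtinianRing R := isArtinian_of_tower K inferInstance
  have h2 : IsArtinianRing Rᵐᵒᵖ := isArtinian_of_tower K inferInstance
  let o := rightRegularEquiv R
  refine ⟨h1, isArtinian_of_linearEquiv o.symm,
    hR.nonempty_moduleSocle_equiv hK, ?_⟩
  obtain ⟨e⟩ := hR.op.nonempty_moduleSocle_equiv hK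
  refine ⟨o.ofSubmodules _ _ (map_moduleSocle o) ≪≫ₗ e ≪≫ₗ
    Submodule.Quotient.equiv _ _ o.symm ?_⟩
  ext x
  constructor
  · rintro ⟨y, hy, rfl⟩
    exact MulOpposite.op_mem_jacobson_iff.mp hy
  · intro hx
    exact ⟨MulOpposite.op x, MulOpposite.op_mem_jacobson hx, rfl⟩

namespace SkewPoly

variable {K A : Type*} [CommRing K] [Ring A] [Algebra K A] {σ : A ≃ₐ[K] A}

/-! ### Coefficients of skew polynomials -/

@[ext] theorem ext {p q : SkewPoly σ} (h : ∀ n, p.coeff n = q.coeff n) : p = q :=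
  SkewPolynomial.ext (R := A) h

@[simp] theorem coeff_zero (n : ℕ) : (0 : SkewPoly σ).coeff n = 0 := rfl

@[simp] theorem coeff_add (p q : SkewPoly σ) (n : ℕ) :
    (p + q).coeff n = p.coeff n + q.coeff n :=
  SkewPolynomial.coeff_add (R := A) p q n

@[simp] theorem coeff_sub (p q : SkewPoly σ) (n : ℕ) :
    (p - q).coeff n = p.coeff n - q.coeff n :=
  SkewPolynomial.coeff_sub (R := A) p q n

@[simp] theorem coeff_smul (k : K) (p : SkewPoly σ) (n : ℕ) :
    (k • p).coeff n = k • p.coeff n :=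
  congrArg (fun c => c (Multiplicative.ofAdd n))
    (SkewMonoidAlgebra.coeff_smul (k := A) (G := Multiplicative ℕ) k p)

/-- Multiplication in `A[x;σ]`: `(∑ pᵢ xⁱ) (∑ qⱼ xʲ) = ∑ pᵢ σⁱ(qⱼ) xⁱ⁺ʲ`. -/
theorem coeff_mul (p q : SkewPoly σ) (n : ℕ) :
    (p * q).coeff n =
      ∑ ij ∈ Finset.HasAntidiagonal.antidiagonal n, p.coeff ij.1 * (σ ^ ij.1) (q.coeff ij.2) := by
  let := powersAction σ
  refine (SkewMonoidAlgebra.coeff_mul_antidiagonal_of_finset (k := A) (G := Multiplicative ℕ) p q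
    (Multiplicative.ofAdd n) (Finset.HasAntidiagonal.antidiagonal (A := ℕ) n :) ?_).trans rfl
  intro ij
  exact Finset.HasAntidiagonal.mem_antidiagonal (A := ℕ)

variable (σ) in
/-- The monomial `a x ^ n`. -/
noncomputable def monomial (n : ℕ) : A →ₗ[K] SkewPoly σ where
  toFun a := SkewPolynomial.monomial (R := A) n a
  map_add' a b := SkewPolynomial.monomial_add n a b
  map_smul' k a := (SkewPolynomial.smul_monomial n k a).symm

theorem coeff_monomial (n : ℕ) (a : A) (k : ℕ) :
    (monomial σ n a).coeff k = if n = k then a else 0 :=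
  SkewPolynomial.coeff_monomial (R := A)

/-- The sum of `c i x ^ i` over `i < N`. -/
noncomputable def ofCoeffs (σ : A ≃ₐ[K] A) (N : ℕ) (c : ℕ → A) : SkewPoly σ :=
  ∑ i ∈ Finset.range N, monomial σ i (c i)

theorem coeff_ofCoeffs (N : ℕ) (c : ℕ → A) (n : ℕ) :
    (ofCoeffs σ N c).coeff n = if n < N then c n else 0 := by
  induction N with
  | zero => simp [ofCoeffs]
  | succ N ih =>
    have h : ofCoeffs σ (N + 1) c = ofCoeffs σ N c + monomial σ N (c N) := Finset.sum_range_succ ..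
    rw [h, coeff_add, ih, coeff_monomial]
    rcases lt_trichotomy n N with h | rfl | h
    · simp [h, h.ne', h.trans (Nat.lt_succ_self N)]
    · simp
    · simp [h.ne, h.not_gt, not_lt.mpr (Nat.succ_le_of_lt h)]

theorem exists_degreeLT (p : SkewPoly σ) : ∃ n, p.DegreeLT n := by
  refine ⟨(SkewPolynomial.support (R := A) p).sup id + 1, fun n hn => ?_⟩
  by_contra h
  have := Finset.le_sup (f := id) (SkewPolynomial.mem_support_iff (R := A).mpr h)
  simp only [id] at this
  omega

theorem DegreeLT.mono {p : SkewPoly σ} {m n : ℕ} (h : p.DegreeLT m) (hmn : m ≤ n) :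
    p.DegreeLT n := fun k hk => h k (hmn.trans hk)

theorem coeff_monomial_mul (i n : ℕ) (a : A) (q : SkewPoly σ) :
    (monomial σ i a * q).coeff (i + n) = a * (σ ^ i) (q.coeff n) := by
  rw [coeff_mul, Finset.sum_eq_single (i, n)]
  · simp [coeff_monomial]
  · intro ij hij hne
    rw [coeff_monomial, if_neg, zero_mul]
    rintro rfl
    exact hne (Prod.ext rfl (Nat.add_left_cancel (Finset.HasAntidiagonal.mem_antidiagonal.mp hij)))
  · simp

theorem coeff_mul_monomial (p : SkewPoly σ) (n i : ℕ) (a : A) :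
    (p * monomial σ i a).coeff (n + i) = p.coeff n * (σ ^ n) a := by
  rw [coeff_mul, Finset.sum_eq_single (n, i)]
  · simp [coeff_monomial]
  · intro ij hij hne
    rw [coeff_monomial, if_neg, map_zero, mul_zero]
    rintro rfl
    exact hne (Prod.ext (Nat.add_right_cancel (Finset.HasAntidiagonal.mem_antidiagonal.mp hij)) rfl)
  · simp

theorem coeff_mul_zero (p q : SkewPoly σ) : (p * q).coeff 0 = p.coeff 0 * q.coeff 0 := by
  simp [coeff_mul]

theorem monomial_zero_one : monomial σ 0 1 = 1 := rfl

/-- A skew polynomial without constant term is a left multiple of `x`. -/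
theorem exists_eq_mul_X {p : SkewPoly σ} (hp : p.coeff 0 = 0) :
    ∃ q : SkewPoly σ, p = q * monomial σ 1 1 ∧ ∀ n, q.coeff n = p.coeff (n + 1) := by
  obtain ⟨N, hN⟩ := p.exists_degreeLT
  have hq : ∀ n, (ofCoeffs σ N fun n => p.coeff (n + 1)).coeff n = p.coeff (n + 1) := by
    intro n
    rw [coeff_ofCoeffs]
    split_ifs with h
    · rfl
    · exact (hN _ (by omega)).symm
  refine ⟨_, ?_, hq⟩
  ext n
  cases n with
  | zero => rw [coeff_mul_zero, hp, coeff_monomial, if_neg one_ne_zero, mul_zero]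
  | succ n => rw [coeff_mul_monomial, hq, map_one, mul_one]

/-- A skew polynomial without constant term is a right multiple of `x`, because `σ` is onto. -/
theorem exists_eq_X_mul {p : SkewPoly σ} (hp : p.coeff 0 = 0) :
    ∃ q : SkewPoly σ, p = monomial σ 1 1 * q ∧ ∀ n, q.coeff n = σ.symm (p.coeff (n + 1)) := by
  obtain ⟨N, hN⟩ := p.exists_degreeLT
  have hq : ∀ n, (ofCoeffs σ N fun n => σ.symm (p.coeff (n + 1))).coeff n =
      σ.symm (p.coeff (n + 1)) := by
    intro n
    rw [coeff_ofCoeffs]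
    split_ifs with h
    · rfl
    · rw [hN _ (by omega), map_zero]
  refine ⟨_, ?_, hq⟩
  ext n
  cases n with
  | zero => rw [coeff_mul_zero, hp, coeff_monomial, if_neg one_ne_zero, zero_mul]
  | succ n =>
    rw [add_comm n 1, coeff_monomial_mul, hq, one_mul, pow_one, AlgEquiv.apply_symm_apply,
      add_comm n 1]

/-! ### Division by a monic skew polynomial -/

/-- Right division by a monic skew polynomial. -/
theorem IsMonicOfDegree.exists_degreeLT_sub_mul {f : SkewPoly σ} {m : ℕ}
    (hf : f.IsMonicOfDegree m) (p : SkewPoly σ) : ∃ q : SkewPoly σ, (p - q * f).DegreeLT m := by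
  obtain ⟨N, hN⟩ := p.exists_degreeLT
  induction N generalizing p with
  | zero => exact ⟨0, by simpa using hN.mono (Nat.zero_le m)⟩
  | succ N ih =>
    rcases Nat.lt_or_ge N m with h | h
    · exact ⟨0, by simpa using hN.mono h⟩
    -- subtracting `p_N x ^ (N - m) f` cancels the leading term of `p`
    obtain ⟨q, hq⟩ := ih (p - monomial σ (N - m) (p.coeff N) * f) fun k hk => by
      obtain ⟨j, rfl⟩ := Nat.exists_eq_add_of_le hk
      have hidx : N + j = (N - m) + (m + j) := by omega
      rw [coeff_sub, hidx, coeff_monomial_mul, ← hidx]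
      cases j with
      | zero => simp [hf.1]
      | succ j => simp [hN (N + (j + 1)) (by omega), hf.2 (m + (j + 1)) (by omega)]
    refine ⟨q + monomial σ (N - m) (p.coeff N), ?_⟩
    rwa [add_mul, add_comm, ← sub_sub]

/-- A nonzero left multiple of a monic skew polynomial of degree `m` has degree at least `m`. -/
theorem IsMonicOfDegree.eq_zero_of_degreeLT_mul {f : SkewPoly σ} {m : ℕ}
    (hf : f.IsMonicOfDegree m) {q : SkewPoly σ} (h : (q * f).DegreeLT m) : q = 0 := by
  obtain ⟨N, hN⟩ := q.exists_degreeLT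
  induction N with
  | zero => ext n; exact hN n (Nat.zero_le n)
  | succ N ih =>
    refine ih fun k hk => ?_
    rcases hk.lt_or_eq with hk | rfl
    · exact hN k hk
    -- the coefficient of `x ^ (N + m)` in `q * f` is `q_N σ ^ N (1) = q_N`
    have hlead : (q * f).coeff (N + m) = q.coeff N := by
      rw [coeff_mul, Finset.sum_eq_single (N, m)]
      · simp [hf.1]
      · rintro ⟨i, j⟩ hij hne
        have hsum : i + j = N + m := Finset.HasAntidiagonal.mem_antidiagonal.mp hij
        rcases lt_trichotomy i N with hi | rfl | hi
        · simp [hf.2 j (by omega)]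
        · exact (hne (Prod.ext rfl (Nat.add_left_cancel hsum))).elim
        · simp [hN i hi]
      · simp
    rw [← hlead]
    exact h _ (by omega)

theorem IsMonicOfDegree.eq_of_mk_eq {f : SkewPoly σ} {m : ℕ} (hf : f.IsMonicOfDegree m)
    [(Ideal.span {f}).IsTwoSided] {r s : SkewPoly σ} (hr : r.DegreeLT m) (hs : s.DegreeLT m)
    (h : Ideal.Quotient.mk (Ideal.span {f}) r = Ideal.Quotient.mk (Ideal.span {f}) s) :
    r = s := by
  obtain ⟨q, hq⟩ := Ideal.mem_span_singleton'.mp (Ideal.Quotient.eq.mp h)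
  have hd : (q * f).DegreeLT m := fun n hn => by
    rw [hq, coeff_sub, hr n hn, hs n hn, sub_zero]
  rw [← sub_eq_zero, ← hq, hf.eq_zero_of_degreeLT_mul hd, zero_mul]

theorem IsMonicOfDegree.exists_mk_eq {f : SkewPoly σ} {m : ℕ} (hf : f.IsMonicOfDegree m)
    [(Ideal.span {f}).IsTwoSided] (u : SkewPoly σ ⧸ Ideal.span {f}) :
    ∃ r : SkewPoly σ, r.DegreeLT m ∧ Ideal.Quotient.mk (Ideal.span {f}) r = u := by
  obtain ⟨p, rfl⟩ := Ideal.Quotient.mk_surjective u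
  obtain ⟨q, hq⟩ := hf.exists_degreeLT_sub_mul p
  refine ⟨_, hq, Ideal.Quotient.eq.mpr (Ideal.mem_span_singleton'.mpr ⟨-q, ?_⟩)⟩
  simp

/-- The monomials of degree less than `m`, with coefficients in `A`, generate the quotient. -/
theorem IsMonicOfDegree.finite_quotient {f : SkewPoly σ} {m : ℕ} (hf : f.IsMonicOfDegree m)
    [(Ideal.span {f}).IsTwoSided] [Module.Finite K A] :
    Module.Finite K (SkewPoly σ ⧸ Ideal.span {f}) := by
  let g : (Fin m → A) →ₗ[K] SkewPoly σ ⧸ Ideal.span {f} :=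
    (Ideal.Quotient.mkₐ K (Ideal.span {f})).toLinearMap ∘ₗ
      ∑ i : Fin m, monomial σ (i : ℕ) ∘ₗ LinearMap.proj i
  refine Module.Finite.of_surjective g fun u => ?_
  obtain ⟨r, hr, rfl⟩ := hf.exists_mk_eq u
  refine ⟨fun i => r.coeff i, congrArg (Ideal.Quotient.mk (Ideal.span {f})) ?_⟩
  have : r = ofCoeffs σ m r.coeff := by
    ext n
    rw [coeff_ofCoeffs]
    split_ifs with h
    · rfl
    · exact hr n (not_lt.mp h)
  conv_rhs => rw [this]
  simp [ofCoeffs, Finset.sum_range]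

/-- The constant term of the remainder modulo a monic skew polynomial, as a linear map on the
quotient. -/
theorem IsMonicOfDegree.exists_constantTerm {f : SkewPoly σ} {m : ℕ} (hf : f.IsMonicOfDegree m)
    [(Ideal.span {f}).IsTwoSided] :
    ∃ c : (SkewPoly σ ⧸ Ideal.span {f}) →ₗ[K] A,
      ∀ r : SkewPoly σ, r.DegreeLT m → c (Ideal.Quotient.mk (Ideal.span {f}) r) = r.coeff 0 := by
  choose rem hdeg hrem using hf.exists_mk_eq
  have key : ∀ u (r : SkewPoly σ), r.DegreeLT m → Ideal.Quotient.mk (Ideal.span {f}) r = u →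
      rem u = r := fun u r hr h => hf.eq_of_mk_eq (hdeg u) hr ((hrem u).trans h.symm)
  refine ⟨{ toFun := fun u => (rem u).coeff 0, map_add' := fun u v => ?_,
            map_smul' := fun k u => ?_ }, fun r hr => ?_⟩
  · rw [← coeff_add, key (u + v) (rem u + rem v)]
    · exact fun n hn => by rw [coeff_add, hdeg u n hn, hdeg v n hn, add_zero]
    · rw [map_add, hrem, hrem]
  · rw [RingHom.id_apply, ← coeff_smul, key (k • u) (k • rem u)]
    · exact fun n hn => by rw [coeff_smul, hdeg u n hn, smul_zero]
    · conv_rhs => rw [← hrem u]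
      rfl
  · exact congrArg (fun p : SkewPoly σ => p.coeff 0) (key _ r hr rfl)

/-! ### The form on the quotient -/

/-- `x` is invertible modulo `f` if the constant term of `f` is a unit: a left inverse comes from
`f ≡ f₀ + w x`, and in an artinian ring left inverses are two-sided. -/
theorem isUnit_mk_X {f : SkewPoly σ} [(Ideal.span {f}).IsTwoSided]
    [IsArtinianRing (SkewPoly σ ⧸ Ideal.span {f})] (hunit : IsUnit (f.coeff 0)) :
    IsUnit (Ideal.Quotient.mk (Ideal.span {f}) (monomial σ 1 1)) := by
  obtain ⟨a, ha⟩ := hunit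
  obtain ⟨w, hw, -⟩ := exists_eq_mul_X (p := f - monomial σ 0 (f.coeff 0)) (by
    simp [coeff_monomial])
  refine IsUnit.of_mul_eq_one_right (Ideal.Quotient.mk (Ideal.span {f})
    (-(monomial σ 0 (↑a⁻¹ : A) * w))) ?_
  have h1 : monomial σ 0 (↑a⁻¹ : A) * monomial σ 0 (f.coeff 0) = 1 := by
    rw [← monomial_zero_one]
    ext n
    rw [← zero_add n, coeff_monomial_mul, coeff_monomial, coeff_monomial, zero_add]
    split_ifs with h
    · simp [← ha]
    · simp
  rw [← map_mul, ← map_one (Ideal.Quotient.mk (Ideal.span {f})), Ideal.Quotient.eq, neg_mul,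
    mul_assoc, ← hw, mul_sub, h1]
  refine Ideal.mem_span_singleton'.mpr ⟨-monomial σ 0 (↑a⁻¹ : A), ?_⟩
  rw [neg_mul]; abel

variable {f : SkewPoly σ} {m : ℕ} [(Ideal.span {f}).IsTwoSided]
  {B : (SkewPoly σ ⧸ Ideal.span {f}) →ₗ[K] (SkewPoly σ ⧸ Ideal.span {f}) →ₗ[K] K} {ε : A →ₗ[K] K}

/-- Left nondegeneracy of `⟨g, h⟩ = ε ((g h)₀)`. Pairing `g` with constants shows `g₀ = 0`, so
`g = g' x` with `g'` of smaller degree, and `g'` is again orthogonal to everything because `x` is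
invertible. -/
theorem eq_zero_of_forall_pairing_left (hass : IsAssociativeForm B)
    (hB : ∀ (g h : SkewPoly σ ⧸ Ideal.span {f}) (r : SkewPoly σ), r.DegreeLT m →
        Ideal.Quotient.mk (Ideal.span {f}) r = g * h → B g h = ε (r.coeff 0))
    (hε : ∀ a, (∀ b, ε (a * b) = 0) → a = 0)
    (hX : IsUnit (Ideal.Quotient.mk (Ideal.span {f}) (monomial σ 1 1)))
    {k : ℕ} (hk : k ≤ m) {r : SkewPoly σ} (hr : r.DegreeLT k)
    (h0 : ∀ h, B (Ideal.Quotient.mk (Ideal.span {f}) r) h = 0) : r = 0 := by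
  induction k generalizing r with
  | zero => ext n; exact hr n (Nat.zero_le n)
  | succ k ih =>
    have hconst : r.coeff 0 = 0 := by
      refine hε _ fun b => ?_
      rw [← h0 (Ideal.Quotient.mk _ (monomial σ 0 b)), hB _ _ (r * monomial σ 0 b) ?_
        (map_mul _ _ _), coeff_mul_zero, coeff_monomial, if_pos rfl]
      intro n hn
      rw [← add_zero n, coeff_mul_monomial, hr n (hk.trans hn), zero_mul]
    obtain ⟨q, rfl, hq⟩ := exists_eq_mul_X hconst
    rw [ih (Nat.le_of_succ_le hk) (r := q), zero_mul]
    · intro n hn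
      rw [hq, hr _ (Nat.succ_le_succ hn)]
    · intro h
      obtain ⟨x, hx⟩ := hX
      have := h0 (↑x⁻¹ * h)
      rwa [map_mul (Ideal.Quotient.mk (Ideal.span {f})), hass, ← hx,
        Units.mul_inv_cancel_left] at this

/-- Right nondegeneracy of `⟨g, h⟩ = ε ((g h)₀)`, by removing factors `x` on the left. -/
theorem eq_zero_of_forall_pairing_right (hass : IsAssociativeForm B)
    (hB : ∀ (g h : SkewPoly σ ⧸ Ideal.span {f}) (r : SkewPoly σ), r.DegreeLT m →
        Ideal.Quotient.mk (Ideal.span {f}) r = g * h → B g h = ε (r.coeff 0))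
    (hε : ∀ a, (∀ b, ε (b * a) = 0) → a = 0)
    (hX : IsUnit (Ideal.Quotient.mk (Ideal.span {f}) (monomial σ 1 1)))
    {k : ℕ} (hk : k ≤ m) {r : SkewPoly σ} (hr : r.DegreeLT k)
    (h0 : ∀ g, B g (Ideal.Quotient.mk (Ideal.span {f}) r) = 0) : r = 0 := by
  induction k generalizing r with
  | zero => ext n; exact hr n (Nat.zero_le n)
  | succ k ih =>
    have hconst : r.coeff 0 = 0 := by
      refine hε _ fun b => ?_
      rw [← h0 (Ideal.Quotient.mk _ (monomial σ 0 b)), hB _ _ (monomial σ 0 b * r) ?_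
        (map_mul _ _ _), coeff_mul_zero, coeff_monomial, if_pos rfl]
      intro n hn
      rw [← zero_add n, coeff_monomial_mul, hr n (hk.trans hn), map_zero, mul_zero]
    obtain ⟨q, rfl, hq⟩ := exists_eq_X_mul hconst
    rw [ih (Nat.le_of_succ_le hk) (r := q), mul_zero]
    · intro n hn
      rw [hq, hr _ (Nat.succ_le_succ hn), map_zero]
    · intro g
      obtain ⟨x, hx⟩ := hX
      have := h0 (g * ↑x⁻¹)
      rwa [map_mul (Ideal.Quotient.mk (Ideal.span {f})), ← hass, ← hx,
        Units.inv_mul_cancel_right] at this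

end SkewPoly

theorem theorem4p4 {K A : Type*} [CommRing K] [Ring A] [Algebra K A]
    (hK : IsFrobeniusRing K) (hA : IsNonprojectiveFrobenius K A)
    (ε : A →ₗ[K] K) (hε : IsFrobeniusFunctional ε)
    (σ : A ≃ₐ[K] A) (m : ℕ) (f : SkewPoly σ)
    (hmonic : f.IsMonicOfDegree m) (hunit : IsUnit (f.coeff 0))
    [hf : (Ideal.span {f}).IsTwoSided] :
    -- every class modulo `f` has exactly one representative of degree less than `m`
    (∀ u : SkewPoly σ ⧸ Ideal.span {f},
      ∃! r : SkewPoly σ, r.DegreeLT m ∧ Ideal.Quotient.mk (Ideal.span {f}) r = u) ∧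
    -- `⟨g, h⟩ = ε ((g h)_0)` is a non degenerate associative bilinear form on the quotient
    (∃ B : (SkewPoly σ ⧸ Ideal.span {f}) →ₗ[K] (SkewPoly σ ⧸ Ideal.span {f}) →ₗ[K] K,
      (∀ (g h : SkewPoly σ ⧸ Ideal.span {f}) (r : SkewPoly σ), r.DegreeLT m →
        Ideal.Quotient.mk (Ideal.span {f}) r = g * h → B g h = ε (r.coeff 0)) ∧
      IsAssociativeForm B ∧ B.Nondegenerate) ∧
    IsNonprojectiveFrobenius K (SkewPoly σ ⧸ Ideal.span {f}) ∧
    IsFrobeniusRing (SkewPoly σ ⧸ Ideal.span {f}) := by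
  obtain ⟨B₀, -, ⟨hleft, hright⟩, hB₀⟩ := hε
  have hεl : ∀ a, (∀ b, ε (a * b) = 0) → a = 0 := fun a h => hleft a fun b => by rw [hB₀, h]
  have hεr : ∀ a, (∀ b, ε (b * a) = 0) → a = 0 := fun a h => hright a fun b => by rw [hB₀, h]
  have := hA.1
  have := hK.isArtinianRing
  have hfin := hmonic.finite_quotient
  have : IsArtinianRing (SkewPoly σ ⧸ Ideal.span {f}) := isArtinian_of_tower K inferInstance
  have hX := SkewPoly.isUnit_mk_X hunit
  obtain ⟨c, hc⟩ := hmonic.exists_constantTerm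
  let B : (SkewPoly σ ⧸ Ideal.span {f}) →ₗ[K] (SkewPoly σ ⧸ Ideal.span {f}) →ₗ[K] K :=
    (LinearMap.mul K (SkewPoly σ ⧸ Ideal.span {f})).compr₂ (ε ∘ₗ c)
  have hB : ∀ (g h : SkewPoly σ ⧸ Ideal.span {f}) (r : SkewPoly σ), r.DegreeLT m →
      Ideal.Quotient.mk (Ideal.span {f}) r = g * h → B g h = ε (r.coeff 0) := by
    intro g h r hr hgh
    rw [← hc r hr, hgh]
    rfl
  have hass : IsAssociativeForm B := fun a b d => congrArg (fun u => ε (c u)) (mul_assoc a b d)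
  have hnon : B.Nondegenerate := by
    constructor
    · intro u hu
      obtain ⟨r, hr, rfl⟩ := hmonic.exists_mk_eq u
      rw [SkewPoly.eq_zero_of_forall_pairing_left hass hB hεl hX le_rfl hr hu, map_zero]
    · intro u hu
      obtain ⟨r, hr, rfl⟩ := hmonic.exists_mk_eq u
      rw [SkewPoly.eq_zero_of_forall_pairing_right hass hB hεr hX le_rfl hr hu, map_zero]
  have hR : IsNonprojectiveFrobenius K (SkewPoly σ ⧸ Ideal.span {f}) := ⟨hfin, B, hass, hnon⟩
  refine ⟨fun u => ?_, ⟨B, hB, hass, hnon⟩, hR, hR.isFrobeniusRing hK⟩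
  obtain ⟨r, hr, rfl⟩ := hmonic.exists_mk_eq u
  exact ⟨r, ⟨hr, rfl⟩, fun s hs => hmonic.eq_of_mk_eq hs.1 hr hs.2⟩
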